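/- **Lifted Daun tiling.** Fix $s,h>0$ and let $U=[0,3s]\times[0,2s]\times[0,h]$ be the unit tile (a block with width-to-depth ratio $3/2$ and arbitrary height). The planar Daun rule divides a rectangle of width $3s$ and depth $2s$, which measures $12\times 8$ on a grid of mesh $s/4$, into sixteen copies of itself scaled by $1/4$ and rotated by multiples of $90^\circ$. The sixteen subtiles, given as (column, row) of the lower left corner in grid units, with the number of counterclockwise quarter turns as a subscript, are $$(0,0)_0,\ (3,0)_2,\ (6,0)_0,\ (9,0)_2,\ (0,2)_1,\ (2,2)_0,\ (5,2)_3,\ (7,2)_2,$$ $$(10,2)_1,\ (2,4)_0,\ (7,4)_2,\ (0,5)_3,\ (5,5)_1,\ (10,5)_3,\ (2,6)_0,\ (7,6)_2.$$ The lifted Daun tiling divides $U$ into $4$ equal horizontal layers, each of which, seen from above, is divided according to the Daun rule; thus $U$ is divided into $64$ subtiles, each the image of $U$ under a similarity of ratio $1/4$ (a rotation about a vertical axis by the given number of quarter turns, a scaling and a translation). Each subtile is divided recursively in the same way, the division being carried over by that similarity. The tiles obtained after $k$ subdivisions are the tiles of level $k$. **Scanning orders.** A space-filling curve (scanning order) based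 on this tiling is given by choosing, for every tile at every level, an order of its $64$ subtiles; this orders the tiles of each level lexicographically. (Orders generated by finitely many recursive rules, possibly applied with rotation, reflection or reversal, are included.) A curve fragment is the union of a set of consecutive tiles in this order. The Arrwwid number of the curve is the smallest number $a$ for which there is a constant $c$ such that every ball $Q\subseteq U$ of positive radius can be covered by at most $a$ curve fragments with total volume at most $c\cdot\mathrm{volume}(Q)$. **Theorem.** Every space-filling curve based on the three-dimensional lifted Daun tiling has Arrwwid number exactly six, whatever order is used. -/

import Mathlib

noncomputable section

namespace LiftedDaun

/-- Euclidean three-space. -/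
abbrev E3 := EuclideanSpace ℝ (Fin 3)

/-! ### Arrwwid numbers -/

/-- `a` is the Arrwwid number of a family `fragments` of regions in the region `U`: it is the least
number such that, for some constant `c`, every ball `Q` that lies in `U` is covered by at most `a`
of the regions, with total volume at most `c` times the volume of `Q`. -/
def IsArrwwidNumber (U : Set E3) (fragments : Set (Set E3)) (a : ℕ) : Prop :=
  IsLeast
    {n : ℕ | ∃ c : NNReal, ∀ (x : E3) (r : ℝ), 0 < r → Metric.closedBall x r ⊆ U →
      ∃ F : Finset (Set E3), F.card ≤ n ∧ (∀ f ∈ F, f ∈ fragments) ∧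
        Metric.closedBall x r ⊆ (⋃ f ∈ F, f) ∧
        (∑ f ∈ F, MeasureTheory.volume f) ≤ c * MeasureTheory.volume (Metric.closedBall x r)}
    a

/-! ### The planar Daun tiling

A rectangle of width `3 * s` and depth `2 * s` is divided into sixteen copies of itself, scaled by
`1 / 4` and rotated by multiples of a right angle. On the grid of mesh `s / 4` the large rectangle
measures 12 by 8, and its subdivision is
```
l l o o o m m p p p n n
l l o o o m m p p p n n
l l j j j m m k k k n n
e e j j j g g k k k i i
e e f f f g g h h h i i
e e f f f g g h h h i i
a a a b b b c c c d d d
a a a b b b c c c d d d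
```
-/

/-- Column (in grid units) of the lower left corner of the `i`-th subtile. -/
def daunCol : Fin 16 → ℕ := ![0, 3, 6, 9, 0, 2, 5, 7, 10, 2, 7, 0, 5, 10, 2, 7]

/-- Row (in grid units) of the lower left corner of the `i`-th subtile. -/
def daunRow : Fin 16 → ℕ := ![0, 0, 0, 0, 2, 2, 2, 2, 2, 4, 4, 5, 5, 5, 6, 6]

/-- Number of counterclockwise quarter turns applied to the rule in the `i`-th subtile. -/
def daunTurn : Fin 16 → Fin 4 := ![0, 2, 0, 2, 1, 0, 3, 2, 1, 0, 2, 3, 1, 3, 0, 2]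

/-- The counterclockwise rotation by `q` quarter turns, followed by the translation that moves the
image of the rectangle `[0, 3 * s] × [0, 2 * s]` back into the corner of the positive quadrant. -/
def quarterTurn (s : ℝ) (q : Fin 4) (x y : ℝ) : ℝ × ℝ :=
  (![(x, y), (2 * s - y, x), (3 * s - x, 2 * s - y), (y, 3 * s - x)] : Fin 4 → ℝ × ℝ) q

/-! ### The lifted Daun tiling -/

/-- The unit tile: a block of width `3 * s`, depth `2 * s` and height `h`. -/
def unitTile (s h : ℝ) : Set E3 :=
  {p | p 0 ∈ Set.Icc 0 (3 * s) ∧ p 1 ∈ Set.Icc 0 (2 * s) ∧ p 2 ∈ Set.Icc 0 h}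

/-- Names of the 64 subtiles of a tile: four layers, with sixteen subtiles in each layer. -/
abbrev Sub := Fin 4 × Fin 16

/-- The similarity, of ratio `1 / 4`, that carries the unit tile to its subtile `i`. -/
def subMap (s h : ℝ) (i : Sub) (p : E3) : E3 :=
  !₂[((quarterTurn s (daunTurn i.2) (p 0) (p 1)).1 + (daunCol i.2 : ℝ) * s) / 4,
     ((quarterTurn s (daunTurn i.2) (p 0) (p 1)).2 + (daunRow i.2 : ℝ) * s) / 4,
     (p 2 + ((i.1 : ℕ) : ℝ) * h) / 4]

/-- The tile with a given address. The address is read from the unit tile downwards: `tile [i, j]`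
is the subtile `j` of the subtile `i` of the unit tile. -/
def tile (s h : ℝ) : List Sub → Set E3
  | [] => unitTile s h
  | i :: w => subMap s h i '' tile s h w

/-! ### Scanning orders (space-filling curves) -/

/-- A scanning order based on the tiling: for every tile of the recursion, an order of its 64
subtiles, given by the position of each subtile. Orders that are generated by finitely many
recursive rules, possibly applied with rotation, reflection or reversal, are special cases. -/
abbrev ScanningOrder := List Sub → (Sub ≃ Fin 64)

/-- The position of the tile with address `w` among all tiles of the same level, in scanning
order. -/
def position : ScanningOrder → List Sub → ℕ
  | _, [] => 0
  | O, i :: w => (O [] i : ℕ) * 64 ^ w.length + position (fun u => O (i :: u)) w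

/-- The curve fragments: regions filled by a set of consecutive tiles. Tiles of several levels may
be refined to a common level, so it suffices to take consecutive tiles of one level `k`. -/
def curveFragments (s h : ℝ) (O : ScanningOrder) : Set (Set E3) :=
  {f | ∃ k a b : ℕ,
    f = ⋃ w ∈ {w : List Sub | w.length = k ∧ a ≤ position O w ∧ position O w ≤ b}, tile s h w}

end LiftedDaun

end

noncomputable section

namespace LiftedDaun

/-! ### The planar tiling on integer grids -/

/-! Upper bound. Level `k` tiles are unions of cells of a grid with meshes `s / 4 ^ k` and `h / 4 ^
k`, so the planar tiling becomes combinatorics of integer cells. The central fact is `noCrossing`: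
no four planar tiles of one level meet in a point. It follows by induction on the level from finite
checks on the rule and the invariant `pose_parity`, which keeps subtile corners on the two sides of
a common edge from coinciding. A ball whose diameter is at most the meshes lies in a 2 × 2 × 2 block
of cells, hence in at most three planar tiles times two layers (`exists_six_tiles`). Taking the
finest such level keeps the volumes comparable.

Lower bound. At level two at least 274 planar vertices have three tiles around them; with the 15
interfaces between layers this gives at least 4110 vertices, each with six distinct tiles. The order
passes only 4095 times from one level-two tile to the next. Consider the level-three tiles in the
corners at such a vertex. If two of the six are consecutive, one of them is the last subtile of its
level-two tile, and a level-three tile is too small to touch two of these vertices. So at some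
vertex no two of the six are consecutive (`exists_nonconsecutive_vertex`). A fragment with interior
points of two of them contains a whole tile of level at most three (`volume_fragment_ge`), which is
too expensive for small balls around the vertex; these need six fragments. -/

/-- Width, in units of `s`, of a tile turned by `q` quarter turns. -/
def tileWidth : Fin 4 → ℕ := ![3, 2, 3, 2]

/-- Depth, in units of `s`, of a tile turned by `q` quarter turns. -/
def tileDepth : Fin 4 → ℕ := ![2, 3, 2, 3]

/-- Column of the lower left corner of subtile `i` in a tile that is turned by `q` quarter turns,
relative to the lower left corner of that tile. -/
def subCol (q : Fin 4) (i : Fin 16) : ℕ :=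
  (![daunCol i, 8 - daunRow i - tileDepth (daunTurn i), 12 - daunCol i - tileWidth (daunTurn i),
    daunRow i] : Fin 4 → ℕ) q

/-- Row of the lower left corner of subtile `i` in a tile that is turned by `q` quarter turns,
relative to the lower left corner of that tile. -/
def subRow (q : Fin 4) (i : Fin 16) : ℕ :=
  (![daunRow i, daunCol i, 8 - daunRow i - tileDepth (daunTurn i),
    12 - daunCol i - tileWidth (daunTurn i)] : Fin 4 → ℕ) q

/-- The turn and the lower left corner of a subtile, on the refined grid. -/
def refine (P : Fin 4 × ℕ × ℕ) (i : Fin 16) : Fin 4 × ℕ × ℕ :=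
  (P.1 + daunTurn i, 4 * P.2.1 + subCol P.1 i, 4 * P.2.2 + subRow P.1 i)

/-- The turn and the lower left corner of the planar tile with a given address. -/
def pose (w : List (Fin 16)) : Fin 4 × ℕ × ℕ := w.foldl refine (0, 0, 0)

/-- The picture of the Daun rule, from the bottom row upwards. -/
def daunGrid : List (List (Fin 16)) :=
  [[0, 0, 0, 1, 1, 1, 2, 2, 2, 3, 3, 3], [0, 0, 0, 1, 1, 1, 2, 2, 2, 3, 3, 3],
   [4, 4, 5, 5, 5, 6, 6, 7, 7, 7, 8, 8], [4, 4, 5, 5, 5, 6, 6, 7, 7, 7, 8, 8],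
   [4, 4, 9, 9, 9, 6, 6, 10, 10, 10, 8, 8], [11, 11, 9, 9, 9, 12, 12, 10, 10, 10, 13, 13],
   [11, 11, 14, 14, 14, 12, 12, 15, 15, 15, 13, 13],
   [11, 11, 14, 14, 14, 12, 12, 15, 15, 15, 13, 13]]

/-- The subtile that contains a given cell in the picture of the Daun rule. -/
def daunCell (x y : ℕ) : Fin 16 := (daunGrid.getD y []).getD x 0

/-- The subtile that contains a given cell of a tile turned by `q` quarter turns. -/
def subAt (q : Fin 4) (x y : ℕ) : Fin 16 :=
  (![daunCell x y, daunCell y (7 - x), daunCell (11 - x) (7 - y), daunCell (11 - y) x] :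
    Fin 4 → Fin 16) q

/-- Address of the level `k` planar tile that contains a given cell of the level `k` grid. -/
def planarAddr : ℕ → ℕ → ℕ → List (Fin 16)
  | 0, _, _ => []
  | k + 1, x, y =>
    let w := planarAddr k (x / 4) (y / 4)
    w ++ [subAt (pose w).1 (x - 4 * (pose w).2.1) (y - 4 * (pose w).2.2)]

/-- The cell `(x, y)` belongs to the planar tile with address `w`. -/
def InTile (w : List (Fin 16)) (x y : ℕ) : Prop :=
  ((pose w).2.1 ≤ x ∧ x < (pose w).2.1 + tileWidth (pose w).1) ∧
    ((pose w).2.2 ≤ y ∧ y < (pose w).2.2 + tileDepth (pose w).1)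

lemma pose_snoc (w : List (Fin 16)) (i : Fin 16) : pose (w ++ [i]) = refine (pose w) i := by
  simp [pose]

lemma sub_bounds : ∀ (q : Fin 4) (i : Fin 16),
    subCol q i + tileWidth (q + daunTurn i) ≤ 4 * tileWidth q ∧
      subRow q i + tileDepth (q + daunTurn i) ≤ 4 * tileDepth q := by
  decide +kernel

lemma tileWidth_le (q : Fin 4) : tileWidth q ≤ 3 := by revert q; decide
lemma tileDepth_le (q : Fin 4) : tileDepth q ≤ 3 := by revert q; decide

/-- With `subAt_unique_offset`, the finite check that the picture agrees with the corner tables in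
all four orientations: the sixteen rectangles partition the cells. -/
lemma subAt_spec : ∀ (q : Fin 4), ∀ x < 4 * tileWidth q, ∀ y < 4 * tileDepth q,
    (subCol q (subAt q x y) ≤ x ∧
      x < subCol q (subAt q x y) + tileWidth (q + daunTurn (subAt q x y))) ∧
    subRow q (subAt q x y) ≤ y ∧
      y < subRow q (subAt q x y) + tileDepth (q + daunTurn (subAt q x y)) := by
  decide +kernel

lemma subAt_unique_offset : ∀ (q : Fin 4) (i : Fin 16), 
    ∀ a < tileWidth (q + daunTurn i), ∀ b < tileDepth (q + daunTurn i),
      subAt q (subCol q i + a) (subRow q i + b) = i := by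
  decide +kernel

lemma subAt_unique (q : Fin 4) (i : Fin 16) (x y : ℕ) (hx : subCol q i ≤ x)
    (hx' : x < subCol q i + tileWidth (q + daunTurn i)) (hy : subRow q i ≤ y)
    (hy' : y < subRow q i + tileDepth (q + daunTurn i)) : subAt q x y = i := by
  have := subAt_unique_offset q i (x - subCol q i) (by omega) (y - subRow q i) (by omega)
  rwa [Nat.add_sub_cancel' hx, Nat.add_sub_cancel' hy] at this

lemma length_planarAddr (k x y : ℕ) : (planarAddr k x y).length = k := by
  induction k generalizing x y with
  | zero => rfl
  | succ k ih => simp [planarAddr, ih]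

/-- Membership descends one level at a time, since dividing cell coordinates by four yields the
parent cell. Hence every cell of the grid lies in exactly one tile of its level, the one named by
`planarAddr`. -/
lemma InTile.snoc_iff {w : List (Fin 16)} {i : Fin 16} {x y : ℕ} :
    InTile (w ++ [i]) x y ↔ InTile w (x / 4) (y / 4) ∧
      subAt (pose w).1 (x - 4 * (pose w).2.1) (y - 4 * (pose w).2.2) = i := by
  rcases hp : pose w with ⟨q, X, Y⟩
  simp only [InTile, pose_snoc, hp, refine]
  have hb := sub_bounds q i
  have h1 := tileWidth_le q
  have h2 := tileDepth_le q
  constructor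
  · rintro ⟨⟨a, b⟩, c, d⟩
    refine ⟨⟨⟨?_, ?_⟩, ?_, ?_⟩, subAt_unique _ _ _ _ ?_ ?_ ?_ ?_⟩ <;> omega
  · rintro ⟨⟨⟨a, b⟩, c, d⟩, rfl⟩
    have := subAt_spec q (x - 4 * X) (by omega) (y - 4 * Y) (by omega)
    omega

lemma InTile.planarAddr_eq {w : List (Fin 16)} {x y : ℕ} (h : InTile w x y) :
    planarAddr w.length x y = w := by
  induction w using List.reverseRecOn generalizing x y with
  | nil => rfl
  | append_singleton w i ih =>
    obtain ⟨h1, h2⟩ := InTile.snoc_iff.1 h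
    rw [List.length_append, List.length_singleton, planarAddr]
    simp only [ih h1, h2]

lemma inTile_planarAddr {k x y : ℕ} (hx : x < 3 * 4 ^ k) (hy : y < 2 * 4 ^ k) :
    InTile (planarAddr k x y) x y := by
  induction k generalizing x y with
  | zero => exact ⟨⟨zero_le, hx⟩, zero_le, hy⟩
  | succ k ih =>
    rw [pow_succ] at hx hy
    exact InTile.snoc_iff.2 ⟨ih (by omega) (by omega), rfl⟩

lemma InTile.eq_planarAddr {k x y : ℕ} {w : List (Fin 16)} (hw : w.length = k)
    (h : InTile w x y) : planarAddr k x y = w := hw ▸ h.planarAddr_eq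

/-! ### No four planar tiles meet in a point -/

/-- The parity that distinguishes the last two turns from the first two. -/
def turnParity : Fin 4 → ℕ := ![0, 0, 1, 1]

lemma subCol_add_subRow_parity : ∀ (q : Fin 4) (i : Fin 16),
    (subCol q i + subRow q i + turnParity (q + daunTurn i)) % 2 = 0 := by
  decide +kernel

/-- The parent's coordinates enter multiplied by four, so the parity is decided by the last
subdivision alone. -/
lemma pose_parity (w : List (Fin 16)) :
    ((pose w).2.1 + (pose w).2.2 + turnParity (pose w).1) % 2 = 0 := by
  induction w using List.reverseRecOn with
  | nil => rfl
  | append_singleton w i _ =>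
    rw [pose_snoc]
    have := subCol_add_subRow_parity (pose w).1 i
    simp only [refine]
    omega

lemma subAt_interior : ∀ (q : Fin 4), ∀ x < 4 * tileWidth q - 1, ∀ y < 4 * tileDepth q - 1,
    subAt q x y = subAt q (x + 1) y ∨ subAt q x (y + 1) = subAt q (x + 1) (y + 1) ∨
      subAt q x y = subAt q x (y + 1) ∨ subAt q (x + 1) y = subAt q (x + 1) (y + 1) := by
  decide +kernel

/-- Along the sides of a tile, subtile corners avoid the vertices of the parent grid. This and
`subAt_left_right` handle vertices inherited from that grid. -/
lemma subAt_top_bottom : ∀ (q : Fin 4), ∀ x < 4 * tileWidth q - 1, x % 4 = 3 →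
    subAt q x (4 * tileDepth q - 1) = subAt q (x + 1) (4 * tileDepth q - 1) ∧
      subAt q x 0 = subAt q (x + 1) 0 := by
  decide +kernel

lemma subAt_left_right : ∀ (q : Fin 4), ∀ y < 4 * tileDepth q - 1, y % 4 = 3 →
    subAt q (4 * tileWidth q - 1) y = subAt q (4 * tileWidth q - 1) (y + 1) ∧
      subAt q 0 y = subAt q 0 (y + 1) := by
  decide +kernel

/-- The congruence is what `pose_parity` gives for two tiles sharing a vertical edge. Under it, at a
vertex strictly inside an edge of a parent cell, at most one of the two sides has a subtile corner.
-/
lemma subAt_side_by_side : ∀ (q q' : Fin 4), ∀ v < tileDepth q, ∀ v' < tileDepth q', ∀ j < 3,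
    (tileWidth q + v + turnParity q) % 2 = (v' + turnParity q') % 2 →
    subAt q (4 * tileWidth q - 1) (4 * v + j) = subAt q (4 * tileWidth q - 1) (4 * v + j + 1) ∨
      subAt q' 0 (4 * v' + j) = subAt q' 0 (4 * v' + j + 1) := by
  decide +kernel

lemma subAt_above : ∀ (q q' : Fin 4), ∀ u < tileWidth q, ∀ u' < tileWidth q', ∀ j < 3,
    (tileDepth q + u + turnParity q) % 2 = (u' + turnParity q') % 2 →
    subAt q (4 * u + j) (4 * tileDepth q - 1) = subAt q (4 * u + j + 1) (4 * tileDepth q - 1) ∨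
      subAt q' (4 * u' + j) 0 = subAt q' (4 * u' + j + 1) 0 := by
  decide +kernel

/-- Among the tiles of the four cells around a grid vertex, two neighbours coincide. -/
def NoCrossing (k x y : ℕ) : Prop :=
  planarAddr k x y = planarAddr k (x + 1) y ∨
    planarAddr k x (y + 1) = planarAddr k (x + 1) (y + 1) ∨
    planarAddr k x y = planarAddr k x (y + 1) ∨
    planarAddr k (x + 1) y = planarAddr k (x + 1) (y + 1)

lemma planarAddr_succ {k x y : ℕ} {w : List (Fin 16)} (h : planarAddr k (x / 4) (y / 4) = w) :
    planarAddr (k + 1) x y =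
      w ++ [subAt (pose w).1 (x - 4 * (pose w).2.1) (y - 4 * (pose w).2.2)] := by
  rw [planarAddr, h]

/-- A tile is a rectangle, so with two opposite cells around the vertex it holds all four, and the
vertex is interior to it. -/
lemma noCrossing_of_inTile {k x y : ℕ} {w : List (Fin 16)} (hw : w.length = k)
    (h : InTile w (x / 4) (y / 4)) (h' : InTile w ((x + 1) / 4) ((y + 1) / 4)) :
    NoCrossing (k + 1) x y := by
  have e00 := planarAddr_succ (h.eq_planarAddr hw)
  have e11 := planarAddr_succ (h'.eq_planarAddr hw)
  have e10 := planarAddr_succ (x := x + 1) (y := y)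
    (InTile.eq_planarAddr hw ⟨h'.1, h.2⟩)
  have e01 := planarAddr_succ (x := x) (y := y + 1)
    (InTile.eq_planarAddr hw ⟨h.1, h'.2⟩)
  rw [NoCrossing, e00, e11, e10, e01]
  obtain ⟨h1, h2⟩ := h
  obtain ⟨h3, h4⟩ := h'
  have := subAt_interior (pose w).1 (x - 4 * (pose w).2.1) (by omega) (y - 4 * (pose w).2.2)
    (by omega)
  rw [Nat.sub_add_comm (by omega), Nat.sub_add_comm (by omega)]
  simpa using this

lemma noCrossing {k x y : ℕ} (hx : x + 1 < 3 * 4 ^ k) (hy : y + 1 < 2 * 4 ^ k) :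
    NoCrossing k x y := by
  induction k generalizing x y with
  | zero => exact Or.inl rfl
  | succ k ih =>
    rw [pow_succ] at hx hy
    have mem00 := inTile_planarAddr (k := k) (x := x / 4) (y := y / 4) (by omega) (by omega)
    have mem10 := inTile_planarAddr (k := k) (x := (x + 1) / 4) (y := y / 4) (by omega) (by omega)
    have mem01 := inTile_planarAddr (k := k) (x := x / 4) (y := (y + 1) / 4) (by omega) (by omega)
    have mem11 := inTile_planarAddr (k := k) (x := (x + 1) / 4) (y := (y + 1) / 4)
      (by omega) (by omega)
    -- The remainders tell whether the vertex is a vertex of the parent grid, lies inside one of its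
    -- edges, or lies inside one of its cells.
    by_cases hjx : x % 4 = 3 <;> by_cases hjy : y % 4 = 3
    · have ex : (x + 1) / 4 = x / 4 + 1 := by omega
      have ey : (y + 1) / 4 = y / 4 + 1 := by omega
      rcases ih (x := x / 4) (y := y / 4) (by omega) (by omega) with e | e | e | e
      · rw [ex, ← e] at mem10
        set w := planarAddr k (x / 4) (y / 4) with hw
        -- The tile provided by induction either surrounds the vertex or has it in the relative
        -- interior of a side.
        by_cases h : InTile w (x / 4) ((y + 1) / 4)
        · exact noCrossing_of_inTile (length_planarAddr _ _ _) mem00 ⟨ex ▸ mem10.1, h.2⟩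
        left
        rw [planarAddr_succ hw.symm, planarAddr_succ (w := w) (by rw [ex, ← e])]
        unfold InTile at *
        have := (subAt_top_bottom (pose w).1 (x - 4 * (pose w).2.1) (by omega) (by omega)).1
        rw [Nat.sub_add_comm (by omega), show y - 4 * (pose w).2.2 =
          4 * tileDepth (pose w).1 - 1 by omega, this]
      · rw [ey, e] at mem01
        rw [ex, ey] at mem11
        set w := planarAddr k (x / 4 + 1) (y / 4 + 1) with hw
        by_cases h : InTile w (x / 4) (y / 4)
        · exact noCrossing_of_inTile (length_planarAddr _ _ _) h (by rwa [ex, ey])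
        right; left
        rw [planarAddr_succ (w := w) (by rw [ey, ← e]),
          planarAddr_succ (w := w) (by rw [ex, ey])]
        unfold InTile at *
        have := (subAt_top_bottom (pose w).1 (x - 4 * (pose w).2.1) (by omega) (by omega)).2
        rw [Nat.sub_add_comm (n := x) (by omega), show y + 1 - 4 * (pose w).2.2 = 0 by omega, this]
      · rw [ey, ← e] at mem01
        set w := planarAddr k (x / 4) (y / 4) with hw
        by_cases h : InTile w ((x + 1) / 4) (y / 4)
        · exact noCrossing_of_inTile (length_planarAddr _ _ _) mem00 ⟨h.1, ey ▸ mem01.2⟩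
        right; right; left
        rw [planarAddr_succ hw.symm, planarAddr_succ (w := w) (by rw [ey, ← e])]
        unfold InTile at *
        have := (subAt_left_right (pose w).1 (y - 4 * (pose w).2.2) (by omega) (by omega)).1
        rw [Nat.sub_add_comm (n := y) (by omega), show x - 4 * (pose w).2.1 =
          4 * tileWidth (pose w).1 - 1 by omega, this]
      · rw [ex, e] at mem10
        rw [ex, ey] at mem11
        set w := planarAddr k (x / 4 + 1) (y / 4 + 1) with hw
        by_cases h : InTile w (x / 4) (y / 4)
        · exact noCrossing_of_inTile (length_planarAddr _ _ _) h (by rwa [ex, ey])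
        right; right; right
        rw [planarAddr_succ (w := w) (by rw [ex, ← e]),
          planarAddr_succ (w := w) (by rw [ex, ey])]
        unfold InTile at *
        have := (subAt_left_right (pose w).1 (y - 4 * (pose w).2.2) (by omega) (by omega)).2
        rw [Nat.sub_add_comm (n := y) (by omega), show x + 1 - 4 * (pose w).2.1 = 0 by omega, this]
    · have ex : (x + 1) / 4 = x / 4 + 1 := by omega
      have ey : (y + 1) / 4 = y / 4 := by omega
      set w := planarAddr k (x / 4) (y / 4) with hw
      set w' := planarAddr k ((x + 1) / 4) (y / 4) with hw'
      by_cases h : InTile w ((x + 1) / 4) (y / 4)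
      · exact noCrossing_of_inTile (length_planarAddr _ _ _) mem00 (by rwa [ey])
      by_cases h' : InTile w' (x / 4) (y / 4)
      · exact noCrossing_of_inTile (length_planarAddr _ _ _) h' (by rwa [ey])
      right; right
      rw [planarAddr_succ hw.symm, planarAddr_succ (w := w) (by rw [ey]),
        planarAddr_succ hw'.symm, planarAddr_succ (w := w') (by rw [ey])]
      clear_value w w'
      have p := pose_parity w
      have p' := pose_parity w'
      unfold InTile at *
      have := subAt_side_by_side (pose w).1 (pose w').1 (y / 4 - (pose w).2.2) (by omega)
        (y / 4 - (pose w').2.2) (by omega) (y % 4) (by omega) (by omega)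
      rw [show x - 4 * (pose w).2.1 = 4 * tileWidth (pose w).1 - 1 by omega,
        show x + 1 - 4 * (pose w').2.1 = 0 by omega, Nat.sub_add_comm (n := y) (by omega),
        Nat.sub_add_comm (n := y) (by omega),
        show y - 4 * (pose w).2.2 = 4 * (y / 4 - (pose w).2.2) + y % 4 by omega,
        show y - 4 * (pose w').2.2 = 4 * (y / 4 - (pose w').2.2) + y % 4 by omega]
      simpa using this
    · have ex : (x + 1) / 4 = x / 4 := by omega
      have ey : (y + 1) / 4 = y / 4 + 1 := by omega
      set w := planarAddr k (x / 4) (y / 4) with hw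
      set w' := planarAddr k (x / 4) ((y + 1) / 4) with hw'
      by_cases h : InTile w (x / 4) ((y + 1) / 4)
      · exact noCrossing_of_inTile (length_planarAddr _ _ _) mem00 (by rwa [ex])
      by_cases h' : InTile w' (x / 4) (y / 4)
      · exact noCrossing_of_inTile (length_planarAddr _ _ _) h' (by rwa [ex])
      rw [NoCrossing, planarAddr_succ hw.symm, planarAddr_succ (w := w) (x := x + 1) (by rw [ex]),
        planarAddr_succ hw'.symm, planarAddr_succ (w := w') (x := x + 1) (by rw [ex])]
      clear_value w w'
      have p := pose_parity w
      have p' := pose_parity w'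
      unfold InTile at *
      have := subAt_above (pose w).1 (pose w').1 (x / 4 - (pose w).2.1) (by omega)
        (x / 4 - (pose w').2.1) (by omega) (x % 4) (by omega) (by omega)
      rw [show y - 4 * (pose w).2.2 = 4 * tileDepth (pose w).1 - 1 by omega,
        show y + 1 - 4 * (pose w').2.2 = 0 by omega, Nat.sub_add_comm (n := x) (by omega),
        Nat.sub_add_comm (n := x) (by omega),
        show x - 4 * (pose w).2.1 = 4 * (x / 4 - (pose w).2.1) + x % 4 by omega,
        show x - 4 * (pose w').2.1 = 4 * (x / 4 - (pose w').2.1) + x % 4 by omega]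
      rcases this with e | e
      · exact Or.inl (by rw [e])
      · exact Or.inr (Or.inl (by rw [e]))
    · exact noCrossing_of_inTile (length_planarAddr _ _ _) mem00
        (by rwa [show (x + 1) / 4 = x / 4 by omega, show (y + 1) / 4 = y / 4 by omega])

/-! ### Layers and addresses of grid cells -/

/-- Address of a layer among the `4 ^ k` layers of level `k`. -/
def layerAddr : ℕ → ℕ → List (Fin 4)
  | 0, _ => []
  | k + 1, z => layerAddr k (z / 4) ++ [Fin.ofNat 4 z]

/-- Number of the layer with a given address. -/
def layerNumber (l : List (Fin 4)) : ℕ := l.foldl (fun z (i : Fin 4) => 4 * z + (i : ℕ)) 0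

lemma layerNumber_snoc (l : List (Fin 4)) (i : Fin 4) :
    layerNumber (l ++ [i]) = 4 * layerNumber l + i := by
  simp [layerNumber]

lemma length_layerAddr (k z : ℕ) : (layerAddr k z).length = k := by
  induction k generalizing z with
  | zero => rfl
  | succ k ih => simp [layerAddr, ih]

lemma layerNumber_layerAddr {k z : ℕ} (hz : z < 4 ^ k) : layerNumber (layerAddr k z) = z := by
  induction k generalizing z with
  | zero => simp only [pow_zero, Nat.lt_one_iff] at hz; subst hz; rfl
  | succ k ih =>
    rw [pow_succ] at hz
    rw [layerAddr, layerNumber_snoc, ih (by omega)]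
    simp only [Fin.ofNat]
    omega

lemma layerAddr_layerNumber (l : List (Fin 4)) : layerAddr l.length (layerNumber l) = l := by
  induction l using List.reverseRecOn with
  | nil => rfl
  | append_singleton l i ih =>
    rw [List.length_append, List.length_singleton, layerAddr, layerNumber_snoc,
      show (4 * layerNumber l + i) / 4 = layerNumber l by omega, ih]
    congr 2
    ext
    simp only [Fin.ofNat]
    omega

/-- Address of the level `k` tile that contains a given cell of the level `k` grid. -/
def cellAddr (k x y z : ℕ) : List Sub := List.zip (layerAddr k z) (planarAddr k x y)

lemma length_cellAddr (k x y z : ℕ) : (cellAddr k x y z).length = k := by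
  simp [cellAddr, length_layerAddr, length_planarAddr]

lemma map_fst_cellAddr (k x y z : ℕ) : (cellAddr k x y z).map Prod.fst = layerAddr k z :=
  List.map_fst_zip (by rw [length_layerAddr, length_planarAddr])

lemma map_snd_cellAddr (k x y z : ℕ) : (cellAddr k x y z).map Prod.snd = planarAddr k x y :=
  List.map_snd_zip (by rw [length_layerAddr, length_planarAddr])

lemma zip_map_fst_map_snd (w : List Sub) : List.zip (w.map Prod.fst) (w.map Prod.snd) = w := by
  induction w with
  | nil => rfl
  | cons i w ih => simp [ih]

/-- The cell `(x, y, z)` belongs to the tile with address `w`. -/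
def InBlock (w : List Sub) (x y z : ℕ) : Prop :=
  InTile (w.map Prod.snd) x y ∧ layerNumber (w.map Prod.fst) = z

lemma InBlock.cellAddr_eq {w : List Sub} {x y z : ℕ} (h : InBlock w x y z) :
    cellAddr w.length x y z = w := by
  rw [cellAddr, h.1.eq_planarAddr (List.length_map _), ← h.2]
  nth_rewrite 1 [← List.length_map (f := Prod.fst)]
  rw [layerAddr_layerNumber, zip_map_fst_map_snd]

lemma inBlock_cellAddr {k x y z : ℕ} (hx : x < 3 * 4 ^ k) (hy : y < 2 * 4 ^ k) (hz : z < 4 ^ k) :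
    InBlock (cellAddr k x y z) x y z := by
  rw [InBlock, map_fst_cellAddr, map_snd_cellAddr]
  exact ⟨inTile_planarAddr hx hy, layerNumber_layerAddr hz⟩

/-! ### Coordinates of the tiles -/

/-- The similarity of ratio `1 / 4 ^ k` that carries the unit tile to a tile of level `k`, given
the pose and the layer number of the latter. -/
def place (s h : ℝ) (k : ℕ) (P : Fin 4 × ℕ × ℕ) (z : ℕ) (p : E3) : E3 :=
  !₂[((quarterTurn s P.1 (p 0) (p 1)).1 + (P.2.1 : ℝ) * s) / 4 ^ k,
     ((quarterTurn s P.1 (p 0) (p 1)).2 + (P.2.2 : ℝ) * s) / 4 ^ k,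
     (p 2 + (z : ℝ) * h) / 4 ^ k]

lemma place_zero (s h : ℝ) : place s h 0 (0, 0, 0) 0 = id := by
  funext p
  ext j
  fin_cases j <;> simp [place, quarterTurn]

/-- Quarter turns compose by adding their numbers; this ties the integer tables `subCol` and
`subRow` to the real similarities. -/
lemma quarterTurn_subtile (s : ℝ) (q : Fin 4) (i : Fin 16) (x y : ℝ) :
    quarterTurn s q (((quarterTurn s (daunTurn i) x y).1 + (daunCol i : ℝ) * s) / 4)
      (((quarterTurn s (daunTurn i) x y).2 + (daunRow i : ℝ) * s) / 4) =
    (((quarterTurn s (q + daunTurn i) x y).1 + (subCol q i : ℝ) * s) / 4,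
      ((quarterTurn s (q + daunTurn i) x y).2 + (subRow q i : ℝ) * s) / 4) := by
  fin_cases q <;> fin_cases i <;>
    simp [quarterTurn, daunTurn, daunCol, daunRow, subCol, subRow, tileWidth, tileDepth] <;>
    first | ring1 | constructor <;> ring1

lemma place_subMap (s h : ℝ) (k : ℕ) (P : Fin 4 × ℕ × ℕ) (z : ℕ) (i : Sub) (p : E3) :
    place s h k P z (subMap s h i p) = place s h (k + 1) (refine P i.2) (4 * z + i.1) p := by
  have := quarterTurn_subtile s P.1 i.2 (p 0) (p 1)
  ext j
  fin_cases j
  · simp [place, subMap, refine, this]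
    field_simp
    ring
  · simp [place, subMap, refine, this]
    field_simp
    ring
  · simp [place, subMap, refine]
    field_simp
    ring

/-- The starting pose and layer are arbitrary so that induction can absorb the head of the address
into the accumulators of the folds. -/
lemma place_image_tile (s h : ℝ) (k : ℕ) (P : Fin 4 × ℕ × ℕ) (z : ℕ) (w : List Sub) :
    place s h k P z '' tile s h w =
      place s h (k + w.length) ((w.map Prod.snd).foldl refine P)
        ((w.map Prod.fst).foldl (fun z (i : Fin 4) => 4 * z + (i : ℕ)) z) '' unitTile s h := by
  induction w generalizing k P z with
  | nil => rfl
  | cons i w ih =>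
    rw [tile, Set.image_image]
    simp only [place_subMap]
    rw [ih, List.length_cons, Nat.add_right_comm, Nat.add_assoc]
    rfl

lemma tile_eq_place (s h : ℝ) (w : List Sub) :
    tile s h w = place s h w.length (pose (w.map Prod.snd)) (layerNumber (w.map Prod.fst)) ''
      unitTile s h := by
  have := place_image_tile s h 0 (0, 0, 0) 0 w
  rw [place_zero, Set.image_id, zero_add] at this
  exact this

/-- A coordinate box. -/
def box (a b : Fin 3 → ℝ) : Set E3 := {p | ∀ j, a j ≤ p j ∧ p j ≤ b j}

lemma mem_box {a b : Fin 3 → ℝ} {p : E3} :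
    p ∈ box a b ↔ (a 0 ≤ p 0 ∧ p 0 ≤ b 0) ∧ (a 1 ≤ p 1 ∧ p 1 ≤ b 1) ∧ a 2 ≤ p 2 ∧ p 2 ≤ b 2 := by
  simp [box, Fin.forall_fin_succ]

lemma place_image_unitTile (s h : ℝ) (k : ℕ) (q : Fin 4) (X Y z : ℕ) :
    place s h k (q, X, Y) z '' unitTile s h =
      {p | (X * s ≤ 4 ^ k * p 0 ∧ 4 ^ k * p 0 ≤ (X + tileWidth q) * s) ∧
        (Y * s ≤ 4 ^ k * p 1 ∧ 4 ^ k * p 1 ≤ (Y + tileDepth q) * s) ∧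
        (z * h ≤ 4 ^ k * p 2 ∧ 4 ^ k * p 2 ≤ (z + 1) * h)} := by
  have h4 : (4 : ℝ) ^ k ≠ 0 := by positivity
  ext p
  constructor
  · rintro ⟨p, ⟨⟨h1, h2⟩, ⟨h3, h4⟩, h5, h6⟩, rfl⟩
    fin_cases q <;> simp [place, quarterTurn, tileWidth, tileDepth, mul_div_cancel₀] <;>
      refine ⟨⟨?_, ?_⟩, ⟨?_, ?_⟩, ?_, ?_⟩ <;> linarith
  · rintro ⟨⟨h1, h2⟩, ⟨h3, h4⟩, h5, h6⟩
    let a := 4 ^ k * p 0 - X * s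
    let b := 4 ^ k * p 1 - Y * s
    refine ⟨!₂[(![(a, b), (b, 2 * s - a), (3 * s - a, 2 * s - b), (3 * s - b, a)] q : ℝ × ℝ).1,
      (![(a, b), (b, 2 * s - a), (3 * s - a, 2 * s - b), (3 * s - b, a)] q : ℝ × ℝ).2,
      4 ^ k * p 2 - z * h], ?_, ?_⟩
    · fin_cases q <;> simp [tileWidth, tileDepth] at * <;>
        refine ⟨⟨?_, ?_⟩, ⟨?_, ?_⟩, ?_, ?_⟩ <;> simp [a, b] <;> linarith
    · ext j
      fin_cases q <;> fin_cases j <;> simp [place, quarterTurn, a, b]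

/-- The tiles in coordinates. -/
lemma mem_tile {s h : ℝ} {w : List Sub} {p : E3} :
    p ∈ tile s h w ↔
      (((pose (w.map Prod.snd)).2.1 : ℝ) * s ≤ 4 ^ w.length * p 0 ∧
        4 ^ w.length * p 0 ≤
          ((pose (w.map Prod.snd)).2.1 + tileWidth (pose (w.map Prod.snd)).1 : ℝ) * s) ∧
      (((pose (w.map Prod.snd)).2.2 : ℝ) * s ≤ 4 ^ w.length * p 1 ∧
        4 ^ w.length * p 1 ≤
          ((pose (w.map Prod.snd)).2.2 + tileDepth (pose (w.map Prod.snd)).1 : ℝ) * s) ∧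
      ((layerNumber (w.map Prod.fst) : ℝ) * h ≤ 4 ^ w.length * p 2 ∧
        4 ^ w.length * p 2 ≤ (layerNumber (w.map Prod.fst) + 1 : ℝ) * h) := by
  rw [tile_eq_place, place_image_unitTile]
  rfl

/-- The closed cell `(x, y, z)` of the level `k` grid. -/
def gridCell (s h : ℝ) (k x y z : ℕ) : Set E3 :=
  {p | (x * s ≤ 4 ^ k * p 0 ∧ 4 ^ k * p 0 ≤ (x + 1) * s) ∧
    (y * s ≤ 4 ^ k * p 1 ∧ 4 ^ k * p 1 ≤ (y + 1) * s) ∧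
    (z * h ≤ 4 ^ k * p 2 ∧ 4 ^ k * p 2 ≤ (z + 1) * h)}

lemma gridCell_subset_tile {s h : ℝ} (hs : 0 < s) {w : List Sub} {x y z : ℕ}
    (hb : InBlock w x y z) : gridCell s h w.length x y z ⊆ tile s h w := by
  rintro p ⟨⟨h1, h2⟩, ⟨h3, h4⟩, h5, h6⟩
  obtain ⟨⟨⟨a, b⟩, c, d⟩, rfl⟩ := hb
  rw [mem_tile]
  have a' : ((pose (w.map Prod.snd)).2.1 : ℝ) ≤ x := by exact_mod_cast a
  have b' : (x : ℝ) + 1 ≤ (pose (w.map Prod.snd)).2.1 + tileWidth (pose (w.map Prod.snd)).1 := by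
    exact_mod_cast b
  have c' : ((pose (w.map Prod.snd)).2.2 : ℝ) ≤ y := by exact_mod_cast c
  have d' : (y : ℝ) + 1 ≤ (pose (w.map Prod.snd)).2.2 + tileDepth (pose (w.map Prod.snd)).1 := by
    exact_mod_cast d
  exact ⟨⟨(mul_le_mul_of_nonneg_right a' hs.le).trans h1,
    h2.trans (mul_le_mul_of_nonneg_right b' hs.le)⟩,
    ⟨(mul_le_mul_of_nonneg_right c' hs.le).trans h3,
    h4.trans (mul_le_mul_of_nonneg_right d' hs.le)⟩, h5, h6⟩

lemma gridCell_subset_tile_cellAddr {s h : ℝ} (hs : 0 < s) {k x y z : ℕ} (hx : x < 3 * 4 ^ k)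
    (hy : y < 2 * 4 ^ k) (hz : z < 4 ^ k) :
    gridCell s h k x y z ⊆ tile s h (cellAddr k x y z) := by
  have := gridCell_subset_tile (h := h) hs (inBlock_cellAddr hx hy hz)
  rwa [length_cellAddr] at this

/-- A tile that contains an interior point of a grid cell of its own level is the tile of that
cell. -/
lemma eq_cellAddr_of_mem_tile {s h : ℝ} (hs : 0 < s) (hh : 0 < h) {w : List Sub} {x y z : ℕ}
    {p : E3} (hp : p ∈ tile s h w)
    (hx : x * s < 4 ^ w.length * p 0 ∧ 4 ^ w.length * p 0 < (x + 1) * s)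
    (hy : y * s < 4 ^ w.length * p 1 ∧ 4 ^ w.length * p 1 < (y + 1) * s)
    (hz : z * h < 4 ^ w.length * p 2 ∧ 4 ^ w.length * p 2 < (z + 1) * h) :
    w = cellAddr w.length x y z := by
  obtain ⟨⟨h1, h2⟩, ⟨h3, h4⟩, h5, h6⟩ := mem_tile.1 hp
  refine (InBlock.cellAddr_eq ⟨⟨⟨?_, ?_⟩, ?_, ?_⟩, le_antisymm ?_ ?_⟩).symm
  · have := lt_of_mul_lt_mul_right (h1.trans_lt hx.2) hs.le
    exact Nat.lt_add_one_iff.1 (Nat.cast_lt (α := ℝ).1 (by push_cast; exact this))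
  · have := lt_of_mul_lt_mul_right (hx.1.trans_le h2) hs.le
    exact_mod_cast this
  · have := lt_of_mul_lt_mul_right (h3.trans_lt hy.2) hs.le
    exact Nat.lt_add_one_iff.1 (Nat.cast_lt (α := ℝ).1 (by push_cast; exact this))
  · have := lt_of_mul_lt_mul_right (hy.1.trans_le h4) hs.le
    exact_mod_cast this
  · have := lt_of_mul_lt_mul_right (h5.trans_lt hz.2) hh.le
    exact Nat.lt_add_one_iff.1 (Nat.cast_lt (α := ℝ).1 (by push_cast; exact this))
  · have := lt_of_mul_lt_mul_right (hz.1.trans_le h6) hh.le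
    exact Nat.lt_add_one_iff.1 (Nat.cast_lt (α := ℝ).1 (by push_cast; exact this))

/-! ### Volumes -/

lemma volume_box (a b : Fin 3 → ℝ) :
    MeasureTheory.volume (box a b) = ∏ j, ENNReal.ofReal (b j - a j) := by
  have : box a b = (MeasurableEquiv.toLp 2 (Fin 3 → ℝ)).symm ⁻¹' Set.Icc a b := by
    ext p
    simp only [box, Set.mem_ofPred_eq, Set.mem_preimage, Set.mem_Icc, Pi.le_def, ← forall_and]
    rfl
  rw [this,
    (EuclideanSpace.volume_preserving_symm_measurableEquiv_toLp (Fin 3)).measure_preimage_equiv,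
    Real.volume_Icc_pi]

/-- The volume of a tile of level `k`. -/
lemma volume_tile {s h : ℝ} (hs : 0 < s) (hh : 0 < h) (w : List Sub) :
    MeasureTheory.volume (tile s h w) = ENNReal.ofReal (6 * s ^ 2 * h / 64 ^ w.length) := by
  have h4 : (0 : ℝ) < 4 ^ w.length := by positivity
  rcases hP : pose (w.map Prod.snd) with ⟨q, X, Y⟩
  have : tile s h w = box
      ![X * s / 4 ^ w.length, Y * s / 4 ^ w.length,
        (layerNumber (w.map Prod.fst) : ℝ) * h / 4 ^ w.length]
      ![(X + tileWidth q) * s / 4 ^ w.length, (Y + tileDepth q) * s / 4 ^ w.length,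
        (layerNumber (w.map Prod.fst) + 1 : ℝ) * h / 4 ^ w.length] := by
    ext p
    rw [mem_tile, mem_box, hP]
    simp [div_le_iff₀ h4, le_div_iff₀ h4, mul_comm]
  rw [this, volume_box, ← ENNReal.ofReal_prod_of_nonneg]
  · congr 1
    have hq : (tileWidth q : ℝ) * tileDepth q = 6 := by
      fin_cases q <;> simp [tileWidth, tileDepth] <;> norm_num
    have e : (64 : ℝ) ^ w.length = 4 ^ w.length * 4 ^ w.length * 4 ^ w.length := by
      rw [← mul_pow, ← mul_pow]; norm_num
    rw [← hq, Fin.prod_univ_three, e]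
    simp
    field_simp
    ring
  · intro j _
    fin_cases j <;> simp <;> gcongr <;> linarith

/-! ### Positions in a scanning order -/

lemma position_lt (O : ScanningOrder) (w : List Sub) : position O w < 64 ^ w.length := by
  induction w generalizing O with
  | nil => simp [position]
  | cons i w ih =>
    have h1 := ih (fun u => O (i :: u))
    have h2 : (O [] i : ℕ) + 1 ≤ 64 := (O [] i).2
    have h3 := Nat.mul_le_mul_right (64 ^ w.length) h2
    rw [position, List.length_cons, pow_succ]
    linarith

lemma position_append (O : ScanningOrder) (w u : List Sub) :
    position O (w ++ u) = position O w * 64 ^ u.length + position (fun v => O (w ++ v)) u := by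
  induction w generalizing O with
  | nil => simp [position]
  | cons i w ih =>
    rw [List.cons_append, position, ih, position, List.length_append, pow_add]
    simp only [List.cons_append]
    ring

lemma position_injective (O : ScanningOrder) {w w' : List Sub} (hl : w.length = w'.length)
    (h : position O w = position O w') : w = w' := by
  induction w generalizing O w' with
  | nil => exact (List.length_eq_zero_iff.1 hl.symm).symm
  | cons i w ih =>
    obtain _ | ⟨j, w'⟩ := w'
    · simp at hl
    have hl' : w.length = w'.length := by simpa using hl
    rw [position, position, ← hl'] at h
    have h1 := position_lt (fun u => O (i :: u)) w
    have h2 := position_lt (fun u => O (j :: u)) w'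
    rw [← hl'] at h2
    have hij : (O [] i : ℕ) = O [] j := by
      have := congrArg (· / 64 ^ w.length) h
      simpa [Nat.mul_add_div, mul_comm _ (64 ^ w.length), Nat.div_eq_of_lt h1,
        Nat.div_eq_of_lt h2] using this
    obtain rfl : i = j := (O []).injective (Fin.ext hij)
    rw [ih (fun u => O (i :: u)) hl' (by omega)]

lemma exists_position_eq (O : ScanningOrder) {k p : ℕ} (hp : p < 64 ^ k) :
    ∃ w : List Sub, w.length = k ∧ position O w = p := by
  induction k generalizing O p with
  | zero => exact ⟨[], rfl, by simp only [pow_zero] at hp; simp only [position]; omega⟩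
  | succ k ih =>
    rw [pow_succ] at hp
    obtain ⟨i, hi⟩ := (O []).surjective ⟨p / 64 ^ k, Nat.div_lt_of_lt_mul hp⟩
    obtain ⟨w, hw, hpos⟩ := ih (fun u => O (i :: u)) (p := p % 64 ^ k)
      (Nat.mod_lt _ (by positivity))
    refine ⟨i :: w, by simp [hw], ?_⟩
    rw [position, hw, hpos, hi, Nat.div_add_mod']

lemma tile_mem_curveFragments (s h : ℝ) (O : ScanningOrder) (w : List Sub) :
    tile s h w ∈ curveFragments s h O := by
  refine ⟨w.length, position O w, position O w, ?_⟩
  have : {v : List Sub | v.length = w.length ∧ position O w ≤ position O v ∧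
      position O v ≤ position O w} = {w} := by
    ext v
    constructor
    · rintro ⟨h1, h2, h3⟩
      exact position_injective O h1 (le_antisymm h3 h2)
    · rintro rfl
      exact ⟨rfl, le_rfl, le_rfl⟩
  rw [this, Set.biUnion_singleton]

/-! ### Covering balls with six tiles -/

/-- The pair starts at the floor of `a`, or at `N - 2` where that pair would leave the grid. -/
lemma exists_cell_pair {N : ℕ} (hN : 2 ≤ N) {a b : ℝ} (ha : 0 ≤ a) (hb : b ≤ N)
    (hab : b - a ≤ 1) :
    ∃ x : ℕ, x + 2 ≤ N ∧ x ≤ a ∧ b ≤ x + 2 := by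
  have h1 := Nat.floor_le ha
  have h2 := Nat.lt_floor_add_one a
  by_cases h : ⌊a⌋₊ + 2 ≤ N
  · exact ⟨⌊a⌋₊, h, h1, by linarith⟩
  · have h3 : ((N - 2 : ℕ) : ℝ) = N - 2 := by push_cast [Nat.cast_sub hN]; ring
    have h4 : ((N - 2 : ℕ) : ℝ) ≤ ⌊a⌋₊ := by exact_mod_cast (by omega)
    exact ⟨N - 2, by omega, by linarith, by linarith⟩

lemma exists_cell {x : ℕ} {a : ℝ} (h1 : x ≤ a) (h2 : a ≤ x + 2) :
    ∃ i < 2, ((x + i : ℕ) : ℝ) ≤ a ∧ a ≤ (x + i : ℕ) + 1 := by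
  by_cases h : a ≤ x + 1
  · exact ⟨0, by simp, by simpa, by simpa⟩
  · exact ⟨1, by simp, by push_cast; linarith, by push_cast; linarith⟩

lemma card_image_planarAddr_le {k x y : ℕ} (hx : x + 1 < 3 * 4 ^ k) (hy : y + 1 < 2 * 4 ^ k) :
    ((Finset.range 2 ×ˢ Finset.range 2).image
      fun p => planarAddr k (x + p.1) (y + p.2)).card ≤ 3 := by
  have e : (Finset.range 2 ×ˢ Finset.range 2).image
      (fun p => planarAddr k (x + p.1) (y + p.2)) =
      {planarAddr k x y, planarAddr k (x + 1) y, planarAddr k x (y + 1),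
        planarAddr k (x + 1) (y + 1)} := by
    rw [show Finset.range 2 ×ˢ Finset.range 2 = {(0, 0), (1, 0), (0, 1), (1, 1)} by decide]
    simp
  rw [e]
  rcases noCrossing hx hy with h | h | h | h <;> rw [h]
  · simpa using Finset.card_le_three
  · simpa using Finset.card_le_three
  · rw [Finset.insert_comm, Finset.insert_eq_of_mem (Finset.mem_insert_self _ _)]
    exact Finset.card_le_three
  · rw [Finset.insert_comm (planarAddr k (x + 1) (y + 1)) (planarAddr k x (y + 1))]
    simpa using Finset.card_le_three

lemma exists_six_tiles {s h : ℝ} (hs : 0 < s) (hh : 0 < h) {k : ℕ} (hk : 1 ≤ k) {c : E3} {r : ℝ}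
    (hr : 0 < r) (hU : Metric.closedBall c r ⊆ unitTile s h) (hrs : 4 ^ k * (2 * r) ≤ s)
    (hrh : 4 ^ k * (2 * r) ≤ h) :
    ∃ A : Finset (List Sub), A.card ≤ 6 ∧ (∀ w ∈ A, w.length = k) ∧
      Metric.closedBall c r ⊆ ⋃ w ∈ A, tile s h w := by
  have hball : ∀ p ∈ Metric.closedBall c r, ∀ j, |p j - c j| ≤ r := fun p hp j => by
    rw [← Real.norm_eq_abs]
    exact (PiLp.norm_apply_le (p - c) j).trans (mem_closedBall_iff_norm.1 hp)
  have hshift : ∀ (j : Fin 3) (t : ℝ), |t| ≤ r →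
      c + EuclideanSpace.single j t ∈ unitTile s h := fun j t ht =>
    hU (by simpa [mem_closedBall_iff_norm] using ht)
  have hrr : |r| ≤ r := (abs_of_pos hr).le
  have hrr' : |-r| ≤ r := by rw [abs_neg]; exact hrr
  have h4 : (4 : ℝ) ≤ 4 ^ k := by
    calc (4 : ℝ) = 4 ^ 1 := by norm_num
      _ ≤ 4 ^ k := pow_le_pow_right₀ (by norm_num) hk
  have h4' : 4 ≤ 4 ^ k := by exact_mod_cast h4
  have h0 : (0 : ℝ) < 4 ^ k := by positivity
  -- In each direction the ball's projection is at most one mesh long, so two adjacent cells hold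
  -- it. The assumption `1 ≤ k` guarantees two layers.
  have key : ∀ (j : Fin 3) (m : ℝ) (n : ℕ), 0 < m → 2 ≤ n * 4 ^ k →
      4 ^ k * (2 * r) ≤ m → 0 ≤ c j - r → c j + r ≤ n * m →
      ∃ x : ℕ, x + 2 ≤ n * 4 ^ k ∧ ∀ p ∈ Metric.closedBall c r,
        ∃ i < 2, ((x + i : ℕ) : ℝ) * m ≤ 4 ^ k * p j ∧ 4 ^ k * p j ≤ ((x + i : ℕ) + 1) * m := by
    intro j m n hm hn hrm h1 h2
    obtain ⟨x, hx, hxa, hxb⟩ := exists_cell_pair hn (a := 4 ^ k * (c j - r) / m)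
      (b := 4 ^ k * (c j + r) / m) (by positivity)
      (by rw [div_le_iff₀ hm]; push_cast; nlinarith)
      (by rw [← sub_div, div_le_one hm]; linarith)
    refine ⟨x, hx, fun p hp => ?_⟩
    obtain ⟨h3, h4⟩ := abs_le.1 (hball p hp j)
    obtain ⟨i, hi, h5, h6⟩ := exists_cell (x := x) (a := 4 ^ k * p j / m)
      (hxa.trans (by gcongr; linarith)) (le_trans (by gcongr; linarith) hxb)
    exact ⟨i, hi, (le_div_iff₀ hm).1 h5, (div_le_iff₀ hm).1 h6⟩
  obtain ⟨x, hx, hx'⟩ := key 0 s 3 hs (by omega) hrs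
    (by simpa using (hshift 0 (-r) hrr').1.1) (by simpa using (hshift 0 r hrr).1.2)
  obtain ⟨y, hy, hy'⟩ := key 1 s 2 hs (by omega) hrs
    (by simpa using (hshift 1 (-r) hrr').2.1.1) (by simpa using (hshift 1 r hrr).2.1.2)
  obtain ⟨z, hz, hz'⟩ := key 2 h 1 hh (by omega) hrh
    (by simpa using (hshift 2 (-r) hrr').2.2.1) (by simpa using (hshift 2 r hrr).2.2.2)
  refine ⟨(((Finset.range 2).image fun i => layerAddr k (z + i)) ×ˢ
    ((Finset.range 2 ×ˢ Finset.range 2).image fun p => planarAddr k (x + p.1) (y + p.2))).image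
      fun q => List.zip q.1 q.2, ?_, ?_, ?_⟩
  · refine Finset.card_image_le.trans ?_
    rw [Finset.card_product]
    have h3 := card_image_planarAddr_le (k := k) (x := x) (y := y) (by omega) (by omega)
    exact (Nat.mul_le_mul Finset.card_image_le h3).trans (by simp)
  · intro w hw
    simp only [Finset.mem_image, Finset.mem_product] at hw
    obtain ⟨q, ⟨⟨i, -, h1⟩, ⟨p, -, h2⟩⟩, rfl⟩ := hw
    simp [← h1, ← h2, length_layerAddr, length_planarAddr]
  · intro p hp
    obtain ⟨a, ha, ha'⟩ := hx' p hp
    obtain ⟨b, hb, hb'⟩ := hy' p hp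
    obtain ⟨e, he, he'⟩ := hz' p hp
    refine Set.mem_biUnion (x := cellAddr k (x + a) (y + b) (z + e)) ?_
      (gridCell_subset_tile_cellAddr hs (by omega) (by omega) (by omega) ⟨ha', hb', he'⟩)
    simp only [Finset.coe_image, Finset.coe_product, Set.mem_image, Set.mem_prod]
    exact ⟨(layerAddr k (z + e), planarAddr k (x + a) (y + b)),
      ⟨⟨e, by simpa using he, rfl⟩, ⟨(a, b), by simp [ha, hb], rfl⟩⟩, rfl⟩

/-- The volume of the Euclidean unit ball. -/
def ballVolume : ℝ := (MeasureTheory.volume (Metric.closedBall (0 : E3) 1)).toReal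

lemma ballVolume_pos : 0 < ballVolume :=
  ENNReal.toReal_pos (Metric.measure_closedBall_pos _ _ one_pos).ne'
    MeasureTheory.measure_closedBall_lt_top.ne

lemma volume_closedBall {c : E3} {r : ℝ} (hr : 0 < r) :
    MeasureTheory.volume (Metric.closedBall c r) = ENNReal.ofReal (ballVolume * r ^ 3) := by
  rw [MeasureTheory.Measure.addHaar_closedBall' _ _ hr.le, finrank_euclideanSpace, Fintype.card_fin,
    mul_comm, ENNReal.ofReal_mul ballVolume_pos.le, ballVolume,
    ENNReal.ofReal_toReal MeasureTheory.measure_closedBall_lt_top.ne]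

/-- The covering is economical if the tiles are not much larger than the ball. -/
lemma sum_volume_tiles_le {s h m : ℝ} (hs : 0 < s) (hh : 0 < h) (hm : 0 < m) {k : ℕ} {c : E3}
    {r : ℝ} (hr : 0 < r) (hmr : m ≤ 4 ^ k * (8 * r)) {A : Finset (List Sub)} (hA : A.card ≤ 6)
    (hlen : ∀ w ∈ A, w.length = k) :
    ∑ f ∈ A.image (tile s h), MeasureTheory.volume f ≤
      (36 * s ^ 2 * h * 512 / (m ^ 3 * ballVolume)).toNNReal *
        MeasureTheory.volume (Metric.closedBall c r) := by
  have hβ := ballVolume_pos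
  calc ∑ f ∈ A.image (tile s h), MeasureTheory.volume f
      ≤ ∑ w ∈ A, MeasureTheory.volume (tile s h w) :=
        Finset.sum_image_le_of_nonneg (fun _ _ => zero_le)
    _ ≤ ∑ w ∈ A, ENNReal.ofReal (6 * s ^ 2 * h / 64 ^ k) :=
        Finset.sum_le_sum fun w hw => by rw [volume_tile hs hh, hlen w hw]
    _ = A.card * ENNReal.ofReal (6 * s ^ 2 * h / 64 ^ k) := by
        rw [Finset.sum_const, nsmul_eq_mul]
    _ ≤ 6 * ENNReal.ofReal (6 * s ^ 2 * h / 64 ^ k) := by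
        gcongr
        exact_mod_cast hA
    _ = ENNReal.ofReal (6 * (6 * s ^ 2 * h / 64 ^ k)) := by
        rw [ENNReal.ofReal_mul (by norm_num)]; norm_num
    _ ≤ ENNReal.ofReal (36 * s ^ 2 * h * 512 / (m ^ 3 * ballVolume) * (ballVolume * r ^ 3)) := by
        apply ENNReal.ofReal_le_ofReal
        -- Here `512 = 8 ^ 3`, while `36` is six tiles times the factor six in the volume of the
        -- unit tile.
        have h1 : m ^ 3 ≤ 64 ^ k * (512 * r ^ 3) := by
          calc m ^ 3 ≤ (4 ^ k * (8 * r)) ^ 3 := by gcongr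
            _ = 64 ^ k * (512 * r ^ 3) := by
              rw [mul_pow, ← pow_mul, mul_comm k, pow_mul]; ring
        rw [show 36 * s ^ 2 * h * 512 / (m ^ 3 * ballVolume) * (ballVolume * r ^ 3) =
          36 * s ^ 2 * h * (512 * r ^ 3 / m ^ 3) by field_simp,
          show 6 * (6 * s ^ 2 * h / 64 ^ k) = 36 * s ^ 2 * h * (1 / 64 ^ k) by ring]
        gcongr ?_ * ?_
        rw [div_le_div_iff₀ (by positivity) (by positivity)]
        linarith
    _ = _ := by
        rw [volume_closedBall hr, ENNReal.ofReal_mul (by positivity)]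
        rfl

lemma covered_by_six {s h : ℝ} (hs : 0 < s) (hh : 0 < h) (O : ScanningOrder) :
    ∃ c : NNReal, ∀ (x : E3) (r : ℝ), 0 < r → Metric.closedBall x r ⊆ unitTile s h →
      ∃ F : Finset (Set E3), F.card ≤ 6 ∧ (∀ f ∈ F, f ∈ curveFragments s h O) ∧
        Metric.closedBall x r ⊆ (⋃ f ∈ F, f) ∧
        (∑ f ∈ F, MeasureTheory.volume f) ≤
          c * MeasureTheory.volume (Metric.closedBall x r) := by
  set m := min s h with hm_def
  have hm : 0 < m := lt_min hs hh
  refine ⟨(36 * s ^ 2 * h * 512 / (m ^ 3 * ballVolume)).toNNReal, fun x r hr hU => ?_⟩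
  suffices ∃ (k : ℕ) (A : Finset (List Sub)), m ≤ 4 ^ k * (8 * r) ∧ A.card ≤ 6 ∧
      (∀ w ∈ A, w.length = k) ∧ Metric.closedBall x r ⊆ ⋃ w ∈ A, tile s h w by
    obtain ⟨k, A, hmr, hA, hlen, hcov⟩ := this
    refine ⟨A.image (tile s h), Finset.card_image_le.trans hA, ?_, ?_,
      sum_volume_tiles_le hs hh hm hr hmr hA hlen⟩
    · intro f hf
      obtain ⟨w, -, rfl⟩ := Finset.mem_image.1 hf
      exact tile_mem_curveFragments s h O w
    · rwa [Finset.set_biUnion_finset_image]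
  -- For large balls the unit tile alone is economical; for the others a level `k ≥ 1` is fine
  -- enough to exist and coarse enough to hold the ball.
  by_cases hbig : m ≤ 8 * r
  · exact ⟨0, {[]}, by simpa using hbig, by simp, by simp, by simpa [tile] using hU⟩
  · push Not at hbig
    -- The largest `k` with `4 ^ k * (2 * r) ≤ m`; maximality gives `m < 4 ^ k * (8 * r)`, the
    -- volume bound.
    obtain ⟨k, hk1, hk2⟩ := exists_nat_pow_near (x := m / (2 * r)) (y := 4)
      ((one_le_div (by positivity)).2 (by linarith)) (by norm_num)
    rw [le_div_iff₀ (by positivity)] at hk1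
    rw [div_lt_iff₀ (by positivity)] at hk2
    have hk : 1 ≤ k := by
      by_contra hk
      obtain rfl : k = 0 := by omega
      norm_num at hk2
      linarith
    obtain ⟨A, hA⟩ := exists_six_tiles hs hh hk hr hU (hk1.trans (min_le_left _ _))
      (hk1.trans (min_le_right _ _))
    exact ⟨k, A, by rw [pow_succ] at hk2; linarith, hA⟩

/-! ### A vertex at which no two of the six tiles are consecutive -/

/-- At the upper right corner of the cell `p` of the second planar grid, at least three tiles of
level two meet. -/
def Branching (p : ℕ × ℕ) : Prop :=
  let w00 := planarAddr 2 p.1 p.2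
  let w10 := planarAddr 2 (p.1 + 1) p.2
  let w01 := planarAddr 2 p.1 (p.2 + 1)
  let w11 := planarAddr 2 (p.1 + 1) (p.2 + 1)
  (w00 ≠ w10 ∧ w00 ≠ w01 ∧ w10 ≠ w01) ∨ (w00 ≠ w10 ∧ w00 ≠ w11 ∧ w10 ≠ w11) ∨
    (w00 ≠ w01 ∧ w00 ≠ w11 ∧ w01 ≠ w11) ∨ (w10 ≠ w01 ∧ w10 ≠ w11 ∧ w01 ≠ w11)

instance : DecidablePred Branching := fun p => by unfold Branching; infer_instance

/-- The interior vertices of the second planar tiling. -/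
def branchings : Finset (ℕ × ℕ) := (Finset.range 47 ×ˢ Finset.range 31).filter Branching

/-- The bound 274 is the least number whose product with 15 exceeds 4095. -/
lemma card_branchings : 274 ≤ branchings.card := by
  decide +kernel

lemma of_mem_branchings {p : ℕ × ℕ} (hp : p ∈ branchings) :
    (p.1 < 47 ∧ p.2 < 31) ∧ Branching p := by
  simpa only [branchings, Finset.mem_filter, Finset.mem_product, Finset.mem_range] using hp

lemma injective_three {α : Type*} {a b c : α} (h : a ≠ b ∧ a ≠ c ∧ b ≠ c) {f : Fin 3 → α}
    (h0 : f 0 = a) (h1 : f 1 = b) (h2 : f 2 = c) : Function.Injective f := by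
  intro i j hij
  fin_cases i <;> fin_cases j <;> simp_all

lemma exists_three_quadrants {X Y : ℕ} (h : Branching (X, Y)) :
    ∃ g : Fin 3 → ℕ × ℕ, (∀ i, (g i).1 < 2 ∧ (g i).2 < 2) ∧
      Function.Injective fun i => planarAddr 2 (X + (g i).1) (Y + (g i).2) := by
  rcases h with h | h | h | h
  · exact ⟨![(0, 0), (1, 0), (0, 1)], by decide, injective_three h rfl rfl rfl⟩
  · exact ⟨![(0, 0), (1, 0), (1, 1)], by decide, injective_three h rfl rfl rfl⟩
  · exact ⟨![(0, 0), (0, 1), (1, 1)], by decide, injective_three h rfl rfl rfl⟩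
  · exact ⟨![(1, 0), (0, 1), (1, 1)], by decide, injective_three h rfl rfl rfl⟩

lemma exists_cellAddr_succ (k x y z : ℕ) :
    ∃ i : Sub, cellAddr (k + 1) x y z = cellAddr k (x / 4) (y / 4) (z / 4) ++ [i] := by
  rw [cellAddr, layerAddr, planarAddr, List.zip_append
    (by rw [length_layerAddr, length_planarAddr])]
  exact ⟨_, rfl⟩

/-- The cell of the third grid in the octant `(a, b, e)` at the vertex `(X + 1, Y + 1, Z + 1)` of the
second grid. -/
def octantAddr (X Y Z a b e : ℕ) : List Sub :=
  cellAddr 3 (4 * X + 3 + a) (4 * Y + 3 + b) (4 * Z + 3 + e)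

lemma length_octantAddr (X Y Z a b e : ℕ) : (octantAddr X Y Z a b e).length = 3 :=
  length_cellAddr _ _ _ _

/-- For `a < 2`, division by four sends `4 * X + 3 + a` to `X + a`, so the level-three tile is a
subtile of the level-two tile in the same octant. -/
lemma position_octantAddr (O : ScanningOrder) {X Y Z a b e : ℕ} (ha : a < 2) (hb : b < 2)
    (he : e < 2) : ∃ d < 64, position O (octantAddr X Y Z a b e) =
      64 * position O (cellAddr 2 (X + a) (Y + b) (Z + e)) + d := by
  obtain ⟨i, hi⟩ := exists_cellAddr_succ 2 (4 * X + 3 + a) (4 * Y + 3 + b) (4 * Z + 3 + e)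
  rw [show (4 * X + 3 + a) / 4 = X + a by omega, show (4 * Y + 3 + b) / 4 = Y + b by omega,
    show (4 * Z + 3 + e) / 4 = Z + e by omega] at hi
  refine ⟨_, position_lt (fun v => O (cellAddr 2 (X + a) (Y + b) (Z + e) ++ v)) [i], ?_⟩
  rw [octantAddr, hi, position_append]
  simp [mul_comm]

lemma exists_nonconsecutive_vertex (O : ScanningOrder) :
    ∃ X < 47, ∃ Y < 31, ∃ Z < 15, ∃ g : Fin 3 → ℕ × ℕ, (∀ i, (g i).1 < 2 ∧ (g i).2 < 2) ∧
      ∀ i j : Fin 3 × Fin 2, i ≠ j →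
        position O (octantAddr X Y Z (g i.1).1 (g i.1).2 i.2) ≠
          position O (octantAddr X Y Z (g j.1).1 (g j.1).2 j.2) ∧
        position O (octantAddr X Y Z (g i.1).1 (g i.1).2 i.2) + 1 ≠
          position O (octantAddr X Y Z (g j.1).1 (g j.1).2 j.2) := by
  by_contra! hcon
  have hcard := card_branchings
  have hB := fun p => of_mem_branchings (p := p)
  generalize branchings = B at hcard hB
  -- Two consecutive level-three tiles in different level-two tiles: the earlier one is last in its
  -- parent, hence the remainder 63, and its parent has a successor among the 4096, hence `p <
  -- 4095`.
  have key : ∀ v ∈ B ×ˢ Finset.range 15, ∃ p < 4095, ∃ a < 2, ∃ b < 2, ∃ e < 2,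
      position O (octantAddr v.1.1 v.1.2 v.2 a b e) = 64 * p + 63 := by
    rintro ⟨⟨X, Y⟩, Z⟩ hv
    obtain ⟨hv, hZ⟩ := Finset.mem_product.1 hv
    rw [Finset.mem_range] at hZ
    obtain ⟨⟨hX, hY⟩, hbr⟩ := hB _ hv
    obtain ⟨g, hg, hinj⟩ := exists_three_quadrants hbr
    obtain ⟨i, j, hij, h⟩ := hcon X hX Y hY Z hZ g hg
    obtain ⟨d, hd, hpi⟩ := position_octantAddr O (X := X) (Y := Y) (Z := Z) (hg i.1).1 (hg i.1).2
      i.2.2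
    obtain ⟨d', hd', hpj⟩ := position_octantAddr O (X := X) (Y := Y) (Z := Z) (hg j.1).1
      (hg j.1).2 j.2.2
    have hlt := position_lt O (cellAddr 2 (X + (g j.1).1) (Y + (g j.1).2) (Z + j.2))
    rw [length_cellAddr] at hlt
    have hne : position O (cellAddr 2 (X + (g i.1).1) (Y + (g i.1).2) (Z + i.2)) ≠
        position O (cellAddr 2 (X + (g j.1).1) (Y + (g j.1).2) (Z + j.2)) := by
      intro e
      have e := position_injective O (by rw [length_cellAddr, length_cellAddr]) e
      apply hij
      refine Prod.ext (hinj ?_) (Fin.ext ?_)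
      · have := congrArg (List.map Prod.snd) e
        rwa [map_snd_cellAddr, map_snd_cellAddr] at this
      · have := congrArg (fun w => layerNumber (List.map Prod.fst w)) e
        simp only [map_fst_cellAddr] at this
        rw [layerNumber_layerAddr (by omega), layerNumber_layerAddr (by omega)] at this
        omega
    have h' := h (by omega)
    refine ⟨position O (cellAddr 2 (X + (g i.1).1) (Y + (g i.1).2) (Z + i.2)), by omega,
      _, (hg i.1).1, _, (hg i.1).2, _, i.2.2, ?_⟩
    simp only
    omega
  choose! f hf a ha b hb e he hpos using key
  -- At least `274 * 15 = 4110` vertices map to 4095 values, so one level-three tile serves two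
  -- vertices.
  obtain ⟨⟨⟨X, Y⟩, Z⟩, hv, ⟨⟨X', Y'⟩, Z'⟩, hv', hne, hff⟩ :=
    Finset.exists_ne_map_eq_of_card_lt_of_maps_to (s := B ×ˢ Finset.range 15)
      (t := Finset.range 4095) (f := f)
      (by rw [Finset.card_product, Finset.card_range, Finset.card_range]
          omega)
      (fun v hv => Finset.mem_coe.2 (Finset.mem_range.2 (hf v (Finset.mem_coe.1 hv))))
  have heq := position_injective O (by rw [length_octantAddr, length_octantAddr])
    ((hpos _ hv).trans ((hff ▸ hpos _ hv').symm))
  have h1 := ha _ hv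
  have h2 := hb _ hv
  have h3 := he _ hv
  have h1' := ha _ hv'
  have h2' := hb _ hv'
  have h3' := he _ hv'
  simp only [Finset.mem_product, Finset.mem_range] at hv hv'
  have b1 := (hB _ hv.1).1
  have b2 := (hB _ hv'.1).1
  have m := inBlock_cellAddr (k := 3) (x := 4 * X + 3 + a ((X, Y), Z))
    (y := 4 * Y + 3 + b ((X, Y), Z)) (z := 4 * Z + 3 + e ((X, Y), Z)) (by omega) (by omega)
    (by omega)
  have m' := inBlock_cellAddr (k := 3) (x := 4 * X' + 3 + a ((X', Y'), Z'))
    (y := 4 * Y' + 3 + b ((X', Y'), Z')) (z := 4 * Z' + 3 + e ((X', Y'), Z')) (by omega)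
    (by omega) (by omega)
  simp only [octantAddr] at heq
  rw [← heq] at m'
  generalize cellAddr 3 _ _ _ = w at m m'
  obtain ⟨⟨⟨m1, m2⟩, m3, m4⟩, m5⟩ := m
  obtain ⟨⟨⟨m1', m2'⟩, m3', m4'⟩, m5'⟩ := m'
  have w1 := tileWidth_le (pose (w.map Prod.snd)).1
  have w2 := tileDepth_le (pose (w.map Prod.snd)).1
  -- Octant cells at different vertices differ by at least three in some coordinate, whereas cells
  -- of one tile differ by at most two.
  apply hne
  simp only [Prod.mk.injEq]
  omega

/-! ### Fragments that contain nonconsecutive tiles are large -/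

/-- The similarity that carries the unit tile to the tile with a given address. -/
def addrMap (s h : ℝ) : List Sub → E3 → E3
  | [] => id
  | i :: w => subMap s h i ∘ addrMap s h w

lemma tile_append (s h : ℝ) (w u : List Sub) :
    tile s h (w ++ u) = addrMap s h w '' tile s h u := by
  induction w with
  | nil => simp [addrMap]
  | cons i w ih => rw [List.cons_append, tile, ih, addrMap, Set.image_comp]

lemma tile_eq_image (s h : ℝ) (w : List Sub) : tile s h w = addrMap s h w '' unitTile s h := by
  simpa [tile] using tile_append s h w []

lemma subtile_subset {s h : ℝ} (hs : 0 < s) (hh : 0 < h) (i : Sub) :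
    tile s h [i] ⊆ unitTile s h := by
  intro p hp
  rw [mem_tile] at hp
  obtain ⟨i₁, i₂⟩ := i
  simp only [List.map_cons, List.map_nil, pose, layerNumber, List.foldl_cons, List.foldl_nil,
    refine, List.length_singleton, mul_zero, zero_add, pow_one] at hp
  obtain ⟨⟨h1, h2⟩, ⟨h3, h4⟩, h5, h6⟩ := hp
  have b := sub_bounds 0 i₂
  rw [zero_add] at b
  have b1 : (subCol 0 i₂ + tileWidth (daunTurn i₂) : ℝ) ≤ 12 := by exact_mod_cast b.1
  have b2 : (subRow 0 i₂ + tileDepth (daunTurn i₂) : ℝ) ≤ 8 := by exact_mod_cast b.2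
  have b3 : ((i₁ : ℕ) : ℝ) + 1 ≤ 4 := by exact_mod_cast i₁.2
  have c1 := mul_le_mul_of_nonneg_right b1 hs.le
  have c2 := mul_le_mul_of_nonneg_right b2 hs.le
  have c3 := mul_le_mul_of_nonneg_right b3 hh.le
  have d1 : 0 ≤ (subCol 0 i₂ : ℝ) * s := by positivity
  have d2 : 0 ≤ (subRow 0 i₂ : ℝ) * s := by positivity
  have d3 : 0 ≤ ((i₁ : ℕ) : ℝ) * h := by positivity
  exact ⟨⟨by linarith, by linarith⟩, ⟨by linarith, by linarith⟩, by linarith, by linarith⟩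

lemma tile_subset_unitTile {s h : ℝ} (hs : 0 < s) (hh : 0 < h) (w : List Sub) :
    tile s h w ⊆ unitTile s h := by
  induction w with
  | nil => rfl
  | cons i w ih => exact (Set.image_mono ih).trans (subtile_subset hs hh i)

lemma tile_append_subset {s h : ℝ} (hs : 0 < s) (hh : 0 < h) (w u : List Sub) :
    tile s h (w ++ u) ⊆ tile s h w := by
  rw [tile_append, tile_eq_image s h w]
  exact Set.image_mono (tile_subset_unitTile hs hh u)

lemma exists_cell_lt {N : ℕ} (hN : 0 < N) {a : ℝ} (h0 : 0 ≤ a) (h1 : a ≤ N) :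
    ∃ x < N, (x : ℝ) ≤ a ∧ a ≤ x + 1 := by
  by_cases h : ⌊a⌋₊ < N
  · exact ⟨⌊a⌋₊, h, Nat.floor_le h0, (Nat.lt_floor_add_one a).le⟩
  · have h2 : ((N - 1 : ℕ) : ℝ) = N - 1 := by push_cast [Nat.cast_sub hN]; ring
    have h3 : (N : ℝ) ≤ ⌊a⌋₊ := by exact_mod_cast not_lt.1 h
    have h4 := Nat.floor_le h0
    exact ⟨N - 1, by omega, by linarith, by linarith⟩

lemma unitTile_subset_iUnion {s h : ℝ} (hs : 0 < s) (hh : 0 < h) (k : ℕ) :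
    unitTile s h ⊆ ⋃ w ∈ {w : List Sub | w.length = k}, tile s h w := by
  rintro p ⟨⟨h1, h2⟩, ⟨h3, h4⟩, h5, h6⟩
  have key : ∀ (t m : ℝ) (n : ℕ), 0 < m → 0 < n → 0 ≤ t → t ≤ n * m →
      ∃ x < n * 4 ^ k, (x : ℝ) * m ≤ 4 ^ k * t ∧ 4 ^ k * t ≤ (x + 1) * m := by
    intro t m n hm hn ht htn
    obtain ⟨x, hx, h7, h8⟩ := exists_cell_lt (N := n * 4 ^ k) (by positivity)
      (a := 4 ^ k * t / m) (by positivity)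
      (by rw [div_le_iff₀ hm]; push_cast
          calc 4 ^ k * t ≤ 4 ^ k * (n * m) := by gcongr
            _ = n * 4 ^ k * m := by ring)
    exact ⟨x, hx, (le_div_iff₀ hm).1 h7, (div_le_iff₀ hm).1 h8⟩
  obtain ⟨x, hx, hx'⟩ := key (p 0) s 3 hs (by norm_num) h1 (by exact_mod_cast h2)
  obtain ⟨y, hy, hy'⟩ := key (p 1) s 2 hs (by norm_num) h3 (by exact_mod_cast h4)
  obtain ⟨z, hz, hz'⟩ := key (p 2) h 1 hh (by norm_num) h5 (by simpa using h6)
  exact Set.mem_biUnion (x := cellAddr k x y z) (length_cellAddr k x y z)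
    (gridCell_subset_tile_cellAddr hs hx hy (by omega) ⟨hx', hy', hz'⟩)

lemma tile_subset_iUnion_append {s h : ℝ} (hs : 0 < s) (hh : 0 < h) (w : List Sub) (k : ℕ)
    {p : E3} (hp : p ∈ tile s h w) : ∃ u : List Sub, u.length = k ∧ p ∈ tile s h (w ++ u) := by
  rw [tile_eq_image] at hp
  obtain ⟨p, hp, rfl⟩ := hp
  obtain ⟨u, hu, hpu⟩ := Set.mem_iUnion₂.1 (unitTile_subset_iUnion hs hh k hp)
  exact ⟨u, hu, by rw [tile_append]; exact Set.mem_image_of_mem _ hpu⟩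

/-- If the fragment is made of tiles of level at most `l`, any one of them is large enough.
Otherwise it runs from inside `v` to inside `v'` and must sweep all of the tile that follows `v`. -/
lemma volume_fragment_ge {s h : ℝ} (hs : 0 < s) (hh : 0 < h) {O : ScanningOrder} {f : Set E3}
    (hf : f ∈ curveFragments s h O) {l : ℕ} {v v' : List Sub} {p p' : E3}
    (hv : ∀ w : List Sub, w.length = l → p ∈ tile s h w → w = v)
    (hv' : ∀ w : List Sub, w.length = l → p' ∈ tile s h w → w = v')
    (hv'l : v'.length = l) (hpos : position O v + 1 < position O v') (hp : p ∈ f) (hp' : p' ∈ f) :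
    ENNReal.ofReal (6 * s ^ 2 * h / 64 ^ l) ≤ MeasureTheory.volume f := by
  obtain ⟨k, a, b, rfl⟩ := hf
  obtain ⟨w, ⟨hwk, hwa, hwb⟩, hpw⟩ := Set.mem_iUnion₂.1 hp
  obtain ⟨w', ⟨hwk', hwa', hwb'⟩, hpw'⟩ := Set.mem_iUnion₂.1 hp'
  rcases le_total k l with hkl | hkl
  · refine le_trans ?_ (MeasureTheory.measure_mono
      (Set.subset_biUnion_of_mem (u := fun w => tile s h w) ⟨hwk, hwa, hwb⟩))
    rw [volume_tile hs hh, hwk]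
    gcongr
    norm_num
  -- The level `l` ancestor of `w` contains `p`, so by uniqueness it is `v`.
  · obtain ⟨u, hu, rfl⟩ : ∃ u, u.length = k - l ∧ w = v ++ u := by
      refine ⟨w.drop l, by rw [List.length_drop, hwk], ?_⟩
      rw [← hv (w.take l) (by rw [List.length_take]; omega)
        (tile_append_subset hs hh _ (w.drop l) (by rwa [List.take_append_drop])),
        List.take_append_drop]
    obtain ⟨u', hu', rfl⟩ : ∃ u, u.length = k - l ∧ w' = v' ++ u := by
      refine ⟨w'.drop l, by rw [List.length_drop, hwk'], ?_⟩
      rw [← hv' (w'.take l) (by rw [List.length_take]; omega)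
        (tile_append_subset hs hh _ (w'.drop l) (by rwa [List.take_append_drop])),
        List.take_append_drop]
    obtain ⟨t, ht, htpos⟩ := exists_position_eq O (k := l) (p := position O v + 1)
      (hpos.trans (hv'l ▸ position_lt O v'))
    rw [← ht, ← volume_tile hs hh t]
    refine MeasureTheory.measure_mono fun q hq => ?_
    obtain ⟨x, hx, hqx⟩ := tile_subset_iUnion_append hs hh t (k - l) hq
    refine Set.mem_biUnion (x := t ++ x)
      ⟨by rw [List.length_append, ht, hx]; omega, hwa.trans ?_, le_trans ?_ hwb'⟩ hqx
    · rw [position_append, position_append, hu, hx, htpos, add_one_mul]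
      have := position_lt (fun y => O (v ++ y)) u
      rw [hu] at this
      omega
    · rw [position_append, position_append, hu', hx, htpos]
      have h1 := position_lt (fun y => O (t ++ y)) x
      rw [hx] at h1
      have h2 := Nat.mul_le_mul_right (64 ^ (k - l)) (Nat.succ_le_of_lt hpos)
      rw [Nat.succ_eq_add_one, add_one_mul] at h2
      omega

/-! ### Small balls at a good vertex -/

/-- The vertex `(X + 1, Y + 1, Z + 1)` of the second grid, displaced by `t` times the size of the
unit cell into the octant `(a, b, e)`. -/
def octantPoint (s h t : ℝ) (X Y Z a b e : ℕ) : E3 :=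
  !₂[(X + 1) * s / 16 + t * ((2 * a - 1) * s), (Y + 1) * s / 16 + t * ((2 * b - 1) * s),
    (Z + 1) * h / 16 + t * ((2 * e - 1) * h)]

/-- The vertex `(X + 1, Y + 1, Z + 1)` of the second grid. -/
def vertex (s h : ℝ) (X Y Z : ℕ) : E3 :=
  !₂[(X + 1) * s / 16, (Y + 1) * s / 16, (Z + 1) * h / 16]

/-- On the third grid the vertex has coordinate `4 * X + 4`, and `t < 1 / 64` keeps the displacement
below one cell. -/
lemma octant_coordinate {m t : ℝ} (hm : 0 < m) (ht : 0 < t) (ht' : t < 1 / 64) (X : ℕ) {a : ℕ}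
    (ha : a < 2) :
    ((4 * X + 3 + a : ℕ) : ℝ) * m < 4 ^ 3 * ((X + 1) * m / 16 + t * ((2 * a - 1) * m)) ∧
      4 ^ 3 * ((X + 1) * m / 16 + t * ((2 * a - 1) * m)) < ((4 * X + 3 + a : ℕ) + 1) * m := by
  have h1 : 0 < t * m := by positivity
  have h2 : t * m < 1 / 64 * m := by gcongr
  interval_cases a <;> push_cast <;> constructor <;> linarith

lemma eq_octantAddr {s h t : ℝ} (hs : 0 < s) (hh : 0 < h) (ht : 0 < t) (ht' : t < 1 / 64)
    {X Y Z a b e : ℕ} (ha : a < 2) (hb : b < 2) (he : e < 2) (w : List Sub) (hw : w.length = 3)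
    (hp : octantPoint s h t X Y Z a b e ∈ tile s h w) : w = octantAddr X Y Z a b e := by
  have := eq_cellAddr_of_mem_tile hs hh hp (x := 4 * X + 3 + a) (y := 4 * Y + 3 + b)
    (z := 4 * Z + 3 + e)
  rw [hw] at this
  exact this (octant_coordinate hs ht ht' X ha) (octant_coordinate hs ht ht' Y hb)
    (octant_coordinate hh ht ht' Z he)

lemma octantPoint_mem_closedBall {s h t : ℝ} (hs : 0 < s) (hh : 0 < h) (ht : 0 < t)
    {X Y Z a b e : ℕ} (ha : a < 2) (hb : b < 2) (he : e < 2) :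
    octantPoint s h t X Y Z a b e ∈ Metric.closedBall (vertex s h X Y Z) (t * (2 * s + h)) := by
  have sq : ∀ a : ℕ, a < 2 → (2 * (a : ℝ) - 1) ^ 2 = 1 := by
    intro a ha
    interval_cases a <;> norm_num
  rw [Metric.mem_closedBall, EuclideanSpace.dist_eq]
  apply Real.sqrt_le_iff.2 ⟨by positivity, ?_⟩
  rw [Fin.sum_univ_three]
  simp only [octantPoint, vertex, Real.dist_eq, sq_abs, PiLp.toLp_apply, Matrix.cons_val,
    add_sub_cancel_left, mul_pow, sq a ha, sq b hb, sq e he, one_mul]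
  have : 0 < t ^ 2 * (2 * s ^ 2 + 4 * (s * h)) := by positivity
  linarith

lemma closedBall_vertex_subset {s h r : ℝ} (hrs : r ≤ s / 16) (hrh : r ≤ h / 16)
    (hs : 0 < s) (hh : 0 < h) {X Y Z : ℕ} (hX : X < 47) (hY : Y < 31) (hZ : Z < 15) :
    Metric.closedBall (vertex s h X Y Z) r ⊆ unitTile s h := by
  intro p hp
  have hball : ∀ j, |p j - vertex s h X Y Z j| ≤ r := fun j => by
    rw [← Real.norm_eq_abs]
    exact (PiLp.norm_apply_le (p - vertex s h X Y Z) j).trans (mem_closedBall_iff_norm.1 hp)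
  have key : ∀ (t m : ℝ) (W n : ℕ), 0 < m → W + 1 < 16 * n → r ≤ m / 16 →
      |t - (W + 1) * m / 16| ≤ r → t ∈ Set.Icc 0 (n * m) := by
    intro t m W n hm hW hr ht
    obtain ⟨h1, h2⟩ := abs_le.1 ht
    have h3 : (W : ℝ) + 2 ≤ 16 * n := by exact_mod_cast hW
    have h4 := mul_le_mul_of_nonneg_right h3 hm.le
    have h5 : 0 ≤ W * m := by positivity
    constructor <;> linarith
  refine ⟨?_, ?_, ?_⟩
  · exact_mod_cast key (p 0) s X 3 hs (by omega) hrs (hball 0)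
  · exact_mod_cast key (p 1) s Y 2 hs (by omega) hrs (hball 1)
  · simpa using key (p 2) h Z 1 hh (by omega) hrh (hball 2)

lemma exists_small_radius {s h : ℝ} (hs : 0 < s) (hh : 0 < h) (C : ℝ) {V : ℝ} (hV : 0 < V) :
    ∃ t : ℝ, 0 < t ∧ t < 1 / 64 ∧ t * (2 * s + h) ≤ s / 16 ∧ t * (2 * s + h) ≤ h / 16 ∧
      C * (t * (2 * s + h)) ^ 3 < V := by
  have e : ∀ {g : ℝ → ℝ} {b : ℝ}, Continuous g → g 0 < b → ∀ᶠ t in nhdsWithin 0 (Set.Ioi 0),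
      g t < b := fun hg hb =>
    ((hg.tendsto 0).mono_left nhdsWithin_le_nhds).eventually_lt_const hb
  obtain ⟨t, h0, h1, h2, h3, h4⟩ := ((eventually_mem_nhdsWithin (a := (0 : ℝ)) (s := Set.Ioi 0)).and
    ((e (g := fun t => t) (b := 1 / 64) (by fun_prop) (by norm_num)).and
    ((e (g := fun t => t * (2 * s + h)) (b := s / 16) (by fun_prop) (by simpa)).and
    ((e (g := fun t => t * (2 * s + h)) (b := h / 16) (by fun_prop) (by simpa)).and
    (e (g := fun t => C * (t * (2 * s + h)) ^ 3) (b := V) (by fun_prop) (by simpa)))))).exists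
  exact ⟨t, h0, h1, h2.le, h3.le, h4⟩

lemma six_le_of_covered {s h : ℝ} (hs : 0 < s) (hh : 0 < h) (O : ScanningOrder) {n : ℕ}
    {c : NNReal}
    (hc : ∀ (x : E3) (r : ℝ), 0 < r → Metric.closedBall x r ⊆ unitTile s h →
      ∃ F : Finset (Set E3), F.card ≤ n ∧ (∀ f ∈ F, f ∈ curveFragments s h O) ∧
        Metric.closedBall x r ⊆ (⋃ f ∈ F, f) ∧
        (∑ f ∈ F, MeasureTheory.volume f) ≤
          c * MeasureTheory.volume (Metric.closedBall x r)) : 6 ≤ n := by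
  by_contra! hn
  obtain ⟨X, hX, Y, hY, Z, hZ, g, hg, hpos⟩ := exists_nonconsecutive_vertex O
  obtain ⟨t, ht, ht', hts, hth, hvol⟩ := exists_small_radius hs hh (c * ballVolume)
    (V := 6 * s ^ 2 * h / 64 ^ 3) (by positivity)
  have hr : 0 < t * (2 * s + h) := by positivity
  obtain ⟨F, hFn, hF, hcov, hsum⟩ := hc (vertex s h X Y Z) _ hr
    (closedBall_vertex_subset hts hth hs hh hX hY hZ)
  have hmem : ∀ i : Fin 3 × Fin 2, ∃ f ∈ F,
      octantPoint s h t X Y Z (g i.1).1 (g i.1).2 i.2 ∈ f := fun i => by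
    simpa using hcov (octantPoint_mem_closedBall hs hh ht (hg i.1).1 (hg i.1).2 i.2.2)
  choose φ hφ hφmem using hmem
  -- Six octant points and fewer than six fragments: two points share a fragment.
  obtain ⟨i, -, j, -, hij, hφij⟩ := Finset.exists_ne_map_eq_of_card_lt_of_maps_to
    (s := Finset.univ) (t := F) (f := φ) (by simpa using hFn.trans_lt hn) (fun i _ => hφ i)
  have large : ENNReal.ofReal (6 * s ^ 2 * h / 64 ^ 3) ≤ MeasureTheory.volume (φ i) := by
    have h1 := hpos i j hij
    have h2 := hpos j i hij.symm
    rcases lt_or_gt_of_ne h1.1 with hlt | hlt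
    · exact volume_fragment_ge hs hh (hF _ (hφ i))
        (eq_octantAddr hs hh ht ht' (hg i.1).1 (hg i.1).2 i.2.2)
        (eq_octantAddr hs hh ht ht' (hg j.1).1 (hg j.1).2 j.2.2) (length_octantAddr _ _ _ _ _ _)
        (by omega) (hφmem i) (hφij ▸ hφmem j)
    · exact volume_fragment_ge hs hh (hF _ (hφ i))
        (eq_octantAddr hs hh ht ht' (hg j.1).1 (hg j.1).2 j.2.2)
        (eq_octantAddr hs hh ht ht' (hg i.1).1 (hg i.1).2 i.2.2) (length_octantAddr _ _ _ _ _ _)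
        (by omega) (hφij ▸ hφmem j) (hφmem i)
  have h1 := (large.trans (Finset.single_le_sum (fun _ _ => zero_le) (hφ i))).trans hsum
  rw [volume_closedBall hr, ← ENNReal.ofReal_coe_nnreal, ← ENNReal.ofReal_mul c.coe_nonneg,
    ENNReal.ofReal_le_ofReal_iff (by have := ballVolume_pos; positivity), ← mul_assoc] at h1
  exact hvol.not_ge h1

end LiftedDaun

end

theorem mainTheorem10 (s h : ℝ) (hs : 0 < s) (hh : 0 < h) (O : LiftedDaun.ScanningOrder) :
    LiftedDaun.IsArrwwidNumber (LiftedDaun.unitTile s h) (LiftedDaun.curveFragments s h O) 6 :=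
  ⟨LiftedDaun.covered_by_six hs hh O, fun _ ⟨_, hc⟩ => LiftedDaun.six_le_of_covered hs hh O hc⟩
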